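/- Let $n\ge 1$ and let $B(x,r)\subset\mathbb{R}^n$ denote the open Euclidean ball with centre $x$ and radius $r>0$. For $0<\delta\le n$ the $\delta$-dimensional Hausdorff content of an arbitrary set $E\subset\mathbb{R}^n$ is $$\mathcal{H}^\delta_\infty(E)=\inf\Big\{\sum_i r_i^\delta : E\subset\bigcup_i B(x_i,r_i)\Big\},$$ where the infimum is taken over all countable or finite collections of open balls covering $E$. For an arbitrary (not necessarily measurable) function $g$ with values in $[0,\infty]$ and a set $\Omega\subset\mathbb{R}^n$, the Choquet integral is $$\int_\Omega g\,d\mathcal{H}^\delta_\infty=\int_0^\infty \mathcal{H}^\delta_\infty(\{x\in\Omega: g(x)>t\})\,dt.$$ For $0\le\kappa<n$ and $f:\mathbb{R}^n\to[-\infty,\infty]$ define the centred fractional maximal function $$\mathcal{M}^n_\kappa f(x)=\sup_{r>0}\frac{r^\kappa}{\mathcal{H}^n_\infty(B(x,r))}\int_{B(x,r)}|f(y)|\,d\mathcal{H}^n_\infty(y).$$ **Theorem.** Let $n\ge1$, $\delta\in(0,n]$, $\kappa\in[0,\delta)$ and $p\in(\delta/n,\delta/\kappa)$, where $\delta/\kappa:=\infty$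 if $\kappa=0$. Then there is a finite constant $c$ depending only on $n,\delta,\kappa,p$ such that $$\Big(\int_{\mathbb{R}^n}\big(\mathcal{M}^n_\kappa f(x)\big)^{\frac{\delta p}{\delta-p\kappa}}\,d\mathcal{H}^\delta_\infty\Big)^{\frac{\delta-p\kappa}{\delta p}}\le c\,\Big(\int_{\mathbb{R}^n}|f(x)|^p\,d\mathcal{H}^\delta_\infty\Big)^{\frac1p}$$ for all functions $f:\mathbb{R}^n\to[-\infty,\infty]$, Lebesgue measurable or not. -/

import Mathlib

open MeasureTheory
open scoped ENNReal NNReal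

noncomputable section

/-- The `δ`-dimensional Hausdorff content `𝓗^δ_∞` on `ℝⁿ` (for `δ > 0`): the infimum of `∑ rᵢ ^ δ`
over all countable or finite covers of `E` by open balls `B(xᵢ, rᵢ)`. The open ball of radius `0`
is empty and contributes `0 ^ δ = 0`, so finite covers are the sequences with only finitely many
nonzero radii. -/
def hausdorffContent {n : ℕ} (δ : ℝ) (E : Set (EuclideanSpace ℝ (Fin n))) : ℝ≥0∞ :=
  ⨅ (x : ℕ → EuclideanSpace ℝ (Fin n)) (r : ℕ → ℝ≥0)
    (_ : E ⊆ ⋃ i, Metric.ball (x i) (r i)), ∑' i, (r i : ℝ≥0∞) ^ δ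

/-- The Choquet integral `∫_Ω f d𝓗^δ_∞ = ∫_0^∞ 𝓗^δ_∞ {x ∈ Ω : f x > t} dt` of an arbitrary
function `f` with values in `[0, ∞]` over an arbitrary set `Ω`. -/
def choquetIntegral {n : ℕ} (δ : ℝ) (Ω : Set (EuclideanSpace ℝ (Fin n)))
    (f : EuclideanSpace ℝ (Fin n) → ℝ≥0∞) : ℝ≥0∞ :=
  ∫⁻ t : ℝ in Set.Ioi 0, hausdorffContent δ {x | x ∈ Ω ∧ ENNReal.ofReal t < f x}

/-- The centred fractional Hausdorff content maximal function
`𝓜^d_κ f (x) = sup_{r > 0} r ^ κ / 𝓗^d_∞ (B(x, r)) * ∫_{B(x, r)} |f| d𝓗^d_∞`. -/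
def fractionalMaximal {n : ℕ} (d κ : ℝ) (f : EuclideanSpace ℝ (Fin n) → EReal)
    (x : EuclideanSpace ℝ (Fin n)) : ℝ≥0∞ :=
  ⨆ (r : ℝ) (_ : 0 < r),
    ENNReal.ofReal r ^ κ / hausdorffContent d (Metric.ball x r) *
      choquetIntegral d (Metric.ball x r) (fun y => (f y).abs)

end

/-!
The proof avoids any subadditivity of the Choquet integral. It rests on the countable
subadditivity of `𝓗^δ_∞` and on restricted estimates for indicator functions, which are then summed
over the dyadic level sets `E_m = {|f| > 2 ^ m}`.

Let `N_E x = sup_r r ^ (κ - n) 𝓗^n_∞ (B(x, r) ∩ E)` (`maximalDensity`). Since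
`𝓗^n_∞ E ≤ (𝓗^δ_∞ E) ^ (n / δ)`, one has the uniform bound `N_E ≤ (𝓗^δ_∞ E) ^ (κ / δ)`
(`maximalDensity_le`). The weak type bound
`𝓗^δ_∞ {N_E > t} ≤ C t ^ (-q₀) (𝓗^δ_∞ E) ^ (n / (n - κ))` with `q₀ = δ / (n - κ)`
(`hausdorffContent_lt_maximalDensity_le`) is obtained from a fixed cover of `E` by balls `B_j`.
A point whose witnessing ball `B(y, ρ)` meets a larger `B_j` lies in `2 B_j`; otherwise the balls
`B_j` meeting `B(y, ρ)` have centres in the closed ball of radius `2ρ`, and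
`ρ ^ δ ≤ t ^ (-q₀) (∑ r_j ^ δ) ^ (κ / (n - κ)) ∑' r_j ^ δ`, where `∑'` extends over those centres.
A disjoint Vitali subfamily charges every `B_j` at most once, so no packing lemma is needed.

Splitting the integral over `t` dyadically gives `𝓜 f ≤ 2 ∑ 2 ^ m N_{E_m}`
(`fractionalMaximal_le_tsum`). Let `F = ∑ 2 ^ (p m) 𝓗^δ_∞ E_m`, which is comparable with
`∫ |f| ^ p d𝓗^δ_∞`, and `θ = 1 - p κ / δ`. At height `F ^ (κ / δ) 2 ^ (k θ)` the
uniform bound takes care of all levels `m < k`, because `θ > 0`, that is `p < δ / κ`. The levels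
`m = k + j` are handled by the weak type bound, with a loss `2 ^ (η j)` that pays for the sum over
`j` (`hausdorffContent_lt_fractionalMaximal_le`). The powers of `F` cancel, and the sum over `k` and
`j` converges because `q₀ θ < p`, that is `p > δ / n`
(`choquetIntegral_fractionalMaximal_rpow_le`).
-/

/-! ### Hausdorff content -/

/-- The inclusion `ℓ¹ ⊆ ℓˢ` for `1 ≤ s`, in `ℝ≥0∞`. -/
theorem tsum_rpow_le_rpow_tsum {ι : Type*} (f : ι → ℝ≥0∞) {s : ℝ} (hs : 1 ≤ s) :
    ∑' i, f i ^ s ≤ (∑' i, f i) ^ s := by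
  have hsplit (a : ℝ≥0∞) : a ^ s = a * a ^ (s - 1) := by
    conv_lhs => rw [show s = 1 + (s - 1) by ring]
    rw [ENNReal.rpow_add_of_nonneg _ _ zero_le_one (by linarith), ENNReal.rpow_one]
  calc ∑' i, f i ^ s ≤ ∑' i, f i * (∑' j, f j) ^ (s - 1) := by
        refine ENNReal.tsum_le_tsum fun i => ?_
        rw [hsplit]
        gcongr
        exact ENNReal.le_tsum i
    _ = (∑' i, f i) ^ s := by rw [ENNReal.tsum_mul_right, ← hsplit]

section Content

variable {n : ℕ} {δ : ℝ}

theorem hausdorffContent_mono {E F : Set (EuclideanSpace ℝ (Fin n))} (h : E ⊆ F) :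
    hausdorffContent δ E ≤ hausdorffContent δ F :=
  iInf_mono fun _ => iInf_mono fun _ => iInf_mono' fun hF => ⟨h.trans hF, le_rfl⟩

theorem hausdorffContent_le_tsum {ι : Type*} [Countable ι] (hδ : 0 < δ)
    {E : Set (EuclideanSpace ℝ (Fin n))} (x : ι → EuclideanSpace ℝ (Fin n)) (r : ι → ℝ≥0)
    (h : E ⊆ ⋃ i, Metric.ball (x i) (r i)) :
    hausdorffContent δ E ≤ ∑' i, (r i : ℝ≥0∞) ^ δ := by
  obtain ⟨e, he⟩ := exists_injective_nat ι
  refine (iInf₂_le_of_le (Function.extend e x 0) (Function.extend e r 0)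
    (iInf_le_of_le ?_ le_rfl)).trans_eq ?_
  · refine h.trans (Set.iUnion_subset fun i => ?_)
    refine Set.Subset.trans ?_ (Set.subset_iUnion _ (e i))
    rw [he.extend_apply, he.extend_apply]
  · rw [← tsum_extend_zero he]
    congr 1 with k
    by_cases hk : ∃ i, e i = k
    · obtain ⟨i, rfl⟩ := hk
      simp only [he.extend_apply]
    · simp [Function.extend_apply' _ _ _ hk, ENNReal.zero_rpow_of_pos hδ]

theorem exists_cover_tsum_lt {E : Set (EuclideanSpace ℝ (Fin n))} {A : ℝ≥0∞}
    (h : hausdorffContent δ E < A) :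
    ∃ (x : ℕ → EuclideanSpace ℝ (Fin n)) (r : ℕ → ℝ≥0),
      E ⊆ ⋃ i, Metric.ball (x i) (r i) ∧ ∑' i, (r i : ℝ≥0∞) ^ δ < A := by
  simp only [hausdorffContent, iInf_lt_iff] at h
  obtain ⟨x, r, hE, hA⟩ := h
  exact ⟨x, r, hE, hA⟩

theorem hausdorffContent_iUnion_le {ι : Type*} [Countable ι] (hδ : 0 < δ)
    (E : ι → Set (EuclideanSpace ℝ (Fin n))) :
    hausdorffContent δ (⋃ i, E i) ≤ ∑' i, hausdorffContent δ (E i) := by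
  refine ENNReal.le_of_forall_pos_le_add fun ε hε hfin => ?_
  obtain ⟨ε', hε', hsum⟩ := ENNReal.exists_pos_sum_of_countable'
    (ENNReal.coe_ne_zero.2 hε.ne') ι
  have hlt (i : ι) : hausdorffContent δ (E i) < hausdorffContent δ (E i) + ε' i :=
    ENNReal.lt_add_right ((ENNReal.le_tsum i).trans_lt hfin).ne (hε' i).ne'
  choose x r hE hA using fun i => exists_cover_tsum_lt (hlt i)
  calc hausdorffContent δ (⋃ i, E i)
      ≤ ∑' p : ι × ℕ, (r p.1 p.2 : ℝ≥0∞) ^ δ := by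
        refine hausdorffContent_le_tsum hδ (fun p : ι × ℕ => x p.1 p.2)
          (fun p : ι × ℕ => r p.1 p.2) ?_
        rw [Set.iUnion_prod']
        exact Set.iUnion_mono hE
    _ = ∑' i, ∑' j, (r i j : ℝ≥0∞) ^ δ :=
        ENNReal.tsum_prod (f := fun i j => (r i j : ℝ≥0∞) ^ δ)
    _ ≤ ∑' i, (hausdorffContent δ (E i) + ε' i) := ENNReal.tsum_le_tsum fun i => (hA i).le
    _ ≤ ∑' i, hausdorffContent δ (E i) + ε := by
        rw [ENNReal.tsum_add]
        gcongr

theorem hausdorffContent_ball_le (hδ : 0 < δ) (x : EuclideanSpace ℝ (Fin n)) (r : ℝ) :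
    hausdorffContent δ (Metric.ball x r) ≤ ENNReal.ofReal r ^ δ := by
  refine (hausdorffContent_le_tsum hδ (fun _ : Unit => x) (fun _ => r.toNNReal) ?_).trans_eq ?_
  · refine Set.Subset.trans ?_ (Set.subset_iUnion _ ())
    exact Metric.ball_subset_ball (Real.le_coe_toNNReal r)
  · rw [tsum_fintype]
    simp [ENNReal.ofReal]

theorem hausdorffContent_empty (hδ : 0 < δ) :
    hausdorffContent δ (∅ : Set (EuclideanSpace ℝ (Fin n))) = 0 := by
  simpa [ENNReal.zero_rpow_of_pos hδ] using
    hausdorffContent_ball_le hδ (0 : EuclideanSpace ℝ (Fin n)) 0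

/-- Comparison of volumes: a cover of a ball of radius `r` has `∑ rᵢ ^ n ≥ r ^ n`. -/
theorem le_hausdorffContent_ball (hn : 1 ≤ n) (x : EuclideanSpace ℝ (Fin n)) {r : ℝ} (hr : 0 < r) :
    ENNReal.ofReal r ^ (n : ℝ) ≤ hausdorffContent (n : ℝ) (Metric.ball x r) := by
  refine le_iInf₂ fun y s => le_iInf fun h => ?_
  have hvol (z : EuclideanSpace ℝ (Fin n)) {t : ℝ} (ht : 0 ≤ t) :
      volume (Metric.ball z t) = ENNReal.ofReal t ^ (n : ℝ) *
        volume (Metric.ball (0 : EuclideanSpace ℝ (Fin n)) 1) := by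
    rcases ht.eq_or_lt with rfl | ht
    · simp [show n ≠ 0 by omega]
    · rw [Measure.addHaar_ball_of_pos _ _ ht, finrank_euclideanSpace_fin, ENNReal.ofReal_pow ht.le,
        ENNReal.rpow_natCast]
  have h1 : volume (Metric.ball x r) ≤ ∑' i, volume (Metric.ball (y i) (s i)) :=
    (measure_mono h).trans (measure_iUnion_le _)
  simp only [hvol _ hr.le, hvol _ NNReal.zero_le_coe, ENNReal.tsum_mul_right] at h1
  rw [ENNReal.mul_le_mul_iff_left (Metric.measure_ball_pos _ _ one_pos).ne'
    measure_ball_lt_top.ne] at h1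
  simpa using h1

/-- For `δ ≤ d`, the `d`-dimensional content is controlled by the `δ`-dimensional one. -/
theorem hausdorffContent_le_rpow (hδ : 0 < δ) {d : ℝ} (hd : δ ≤ d)
    (E : Set (EuclideanSpace ℝ (Fin n))) :
    hausdorffContent d E ≤ hausdorffContent δ E ^ (d / δ) := by
  have hs : 1 ≤ d / δ := (one_le_div hδ).2 hd
  rw [← ENNReal.rpow_inv_le_iff (by linarith)]
  refine le_iInf₂ fun y s => le_iInf fun h => ?_
  rw [ENNReal.rpow_inv_le_iff (by linarith)]
  refine (hausdorffContent_le_tsum (hδ.trans_le hd) y s h).trans ?_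
  refine le_trans (le_of_eq ?_) (tsum_rpow_le_rpow_tsum _ hs)
  congr 1 with i
  rw [← ENNReal.rpow_mul, mul_div_cancel₀ _ hδ.ne']

end Content

/-! ### Restricted weak type estimate for indicator functions -/

section Density

variable {n : ℕ} {δ d κ : ℝ}

/-- The centred fractional maximal function of the indicator of `E`, with `𝓗^d_∞ (B(x, r))`
replaced by `r ^ d`. -/
noncomputable def maximalDensity (d κ : ℝ) (E : Set (EuclideanSpace ℝ (Fin n)))
    (x : EuclideanSpace ℝ (Fin n)) : ℝ≥0∞ :=
  ⨆ (r : ℝ) (_ : 0 < r),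
    ENNReal.ofReal r ^ κ / ENNReal.ofReal r ^ d * hausdorffContent d (Metric.ball x r ∩ E)

theorem maximalDensity_le (hδ : 0 < δ) (hd : δ ≤ d) (hκ : 0 ≤ κ) (hκd : κ < d)
    (E : Set (EuclideanSpace ℝ (Fin n))) (x : EuclideanSpace ℝ (Fin n)) :
    maximalDensity d κ E x ≤ hausdorffContent δ E ^ (κ / δ) := by
  refine iSup₂_le fun r hr => ?_
  set ρ := ENNReal.ofReal r
  have hρ0 : ρ ≠ 0 := by simpa [ρ] using hr
  have hρt : ρ ≠ ∞ := ENNReal.ofReal_ne_top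
  set h := hausdorffContent δ E ^ δ⁻¹ with hh
  have hd0 : 0 < d := hδ.trans_le hd
  have h1 : hausdorffContent d (Metric.ball x r ∩ E) ≤ ρ ^ d :=
    (hausdorffContent_mono Set.inter_subset_left).trans (hausdorffContent_ball_le hd0 x r)
  have h2 : hausdorffContent d (Metric.ball x r ∩ E) ≤ h ^ d := by
    refine (hausdorffContent_mono Set.inter_subset_right).trans
      ((hausdorffContent_le_rpow hδ hd E).trans_eq ?_)
    rw [hh, ← ENNReal.rpow_mul, div_eq_inv_mul]
  rw [div_eq_inv_mul, ENNReal.rpow_mul, ← hh, ← ENNReal.rpow_sub _ _ hρ0 hρt]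
  rcases le_or_gt ρ h with hle | hlt
  · calc ρ ^ (κ - d) * hausdorffContent d (Metric.ball x r ∩ E) ≤ ρ ^ (κ - d) * ρ ^ d := by gcongr
      _ = ρ ^ κ := by rw [← ENNReal.rpow_add _ _ hρ0 hρt]; congr 1; ring
      _ ≤ h ^ κ := by gcongr
  · rcases eq_or_ne h 0 with h0 | h0
    · rw [h0, ENNReal.zero_rpow_of_pos hd0, nonpos_iff_eq_zero] at h2
      simp [h2]
    · calc ρ ^ (κ - d) * hausdorffContent d (Metric.ball x r ∩ E) ≤ h ^ (κ - d) * h ^ d := by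
            gcongr 1
            rw [← neg_sub d κ, ENNReal.rpow_neg, ENNReal.rpow_neg, ENNReal.inv_le_inv]
            exact ENNReal.rpow_le_rpow hlt.le (by linarith)
        _ = h ^ κ := by rw [← ENNReal.rpow_add _ _ h0 (hlt.trans_le le_top).ne]; congr 1; ring

/-- The radius bound behind the weak type estimate. Only covering balls smaller than `B(y, ρ)` are
allowed to meet `B(y, ρ)`, so those that do have their centres in the closed ball of radius
`2ρ`, and they carry all the content of `E` inside `B(y, ρ)`. -/
theorem rpow_radius_le_of_lt (hδ : 0 < δ) (hd : δ ≤ d) (hκ : 0 ≤ κ) (hκd : κ < d)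
    {E : Set (EuclideanSpace ℝ (Fin n))} (x : ℕ → EuclideanSpace ℝ (Fin n)) (r : ℕ → ℝ≥0)
    (hE : E ⊆ ⋃ i, Metric.ball (x i) (r i)) {t : ℝ≥0∞} (ht0 : t ≠ 0) (htt : t ≠ ∞)
    {y : EuclideanSpace ℝ (Fin n)} (hy : y ∉ ⋃ i, Metric.ball (x i) (2 * r i))
    {ρ : ℝ} (hρ : 0 < ρ)
    (hlt : t < ENNReal.ofReal ρ ^ κ / ENNReal.ofReal ρ ^ d *
      hausdorffContent d (Metric.ball y ρ ∩ E)) :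
    ENNReal.ofReal ρ ^ δ ≤ t ^ (-(δ / (d - κ))) *
      (∑' i, (r i : ℝ≥0∞) ^ δ) ^ (κ / (d - κ)) *
        ∑' i : {i | x i ∈ Metric.closedBall y (2 * ρ)}, (r i : ℝ≥0∞) ^ δ := by
  set J := {i | x i ∈ Metric.closedBall y (2 * ρ)} with hJ
  set S := ∑' i : J, (r i : ℝ≥0∞) ^ δ with hS
  set σ := ENNReal.ofReal ρ with hσ
  have hσ0 : σ ≠ 0 := by simpa [σ] using hρ
  have hσt : σ ≠ ∞ := ENNReal.ofReal_ne_top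
  have hd0 : 0 < d := hδ.trans_le hd
  have hdκ : 0 < d - κ := by linarith
  have hcov : Metric.ball y ρ ∩ E ⊆ ⋃ i : J, Metric.ball (x i) (r i) := by
    rintro z ⟨hz, hzE⟩
    obtain ⟨i, hi⟩ := Set.mem_iUnion.1 (hE hzE)
    have hyi : 2 * (r i : ℝ) ≤ dist y (x i) := by
      by_contra! h
      exact hy (Set.mem_iUnion.2 ⟨i, h⟩)
    rw [Metric.mem_ball] at hz hi
    have h1 : dist y (x i) ≤ dist z y + dist z (x i) := dist_triangle_left _ _ _
    refine Set.mem_iUnion.2 ⟨⟨i, ?_⟩, hi⟩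
    rw [hJ, Set.mem_ofPred_eq, Metric.mem_closedBall, dist_comm]
    linarith
  have hcont : hausdorffContent d (Metric.ball y ρ ∩ E) ≤ S ^ (d / δ) := by
    refine (hausdorffContent_le_tsum hd0 _ _ hcov).trans
      (le_trans (le_of_eq ?_) (tsum_rpow_le_rpow_tsum _ ((one_le_div hδ).2 hd)))
    congr 1 with i
    rw [← ENNReal.rpow_mul, mul_div_cancel₀ _ hδ.ne']
  have h1 : t * σ ^ (d - κ) ≤ S ^ (d / δ) := by
    calc t * σ ^ (d - κ) ≤ σ ^ κ / σ ^ d * S ^ (d / δ) * σ ^ (d - κ) := by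
          gcongr
          exact hlt.le.trans (by gcongr)
      _ = σ ^ (κ - d + (d - κ)) * S ^ (d / δ) := by
          rw [ENNReal.rpow_add _ _ hσ0 hσt, ENNReal.rpow_sub κ d hσ0 hσt]; ring
      _ = S ^ (d / δ) := by simp
  have h2 : S ≤ ∑' i, (r i : ℝ≥0∞) ^ δ :=
    ENNReal.tsum_comp_le_tsum_of_injective Subtype.val_injective _
  have hq : 0 ≤ δ / (d - κ) := by positivity
  calc σ ^ δ = t ^ (-(δ / (d - κ))) * (t * σ ^ (d - κ)) ^ (δ / (d - κ)) := by
        rw [ENNReal.mul_rpow_of_nonneg _ _ hq, ← mul_assoc, ← ENNReal.rpow_add _ _ ht0 htt,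
          neg_add_cancel, ENNReal.rpow_zero, one_mul, ← ENNReal.rpow_mul,
          mul_div_cancel₀ _ hdκ.ne']
    _ ≤ t ^ (-(δ / (d - κ))) * (S ^ (d / δ)) ^ (δ / (d - κ)) := by gcongr
    _ = t ^ (-(δ / (d - κ))) * S ^ (κ / (d - κ)) * S := by
        rw [← ENNReal.rpow_mul, mul_assoc]
        nth_rw 3 [← ENNReal.rpow_one S]
        rw [← ENNReal.rpow_add_of_nonneg _ _ (by positivity) zero_le_one]
        congr 2
        field_simp
        ring
    _ ≤ _ := by gcongr

/-- The weak type estimate in terms of a fixed cover of `E`. Points near a covering ball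
are covered by its double. For the others, a Vitali subfamily of the balls `B(y, 2ρ)` is
disjoint, so that each covering ball is charged at most once. -/
theorem hausdorffContent_lt_maximalDensity_le_of_cover (hδ : 0 < δ) (hd : δ ≤ d) (hκ : 0 ≤ κ)
    (hκd : κ < d) {E : Set (EuclideanSpace ℝ (Fin n))} (x : ℕ → EuclideanSpace ℝ (Fin n))
    (r : ℕ → ℝ≥0) (hE : E ⊆ ⋃ i, Metric.ball (x i) (r i)) {t : ℝ≥0∞} (ht0 : t ≠ 0) (htt : t ≠ ∞) :
    hausdorffContent δ {y | t < maximalDensity d κ E y} ≤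
      (2 ^ δ + 11 ^ δ) * t ^ (-(δ / (d - κ))) * (∑' i, (r i : ℝ≥0∞) ^ δ) ^ (d / (d - κ)) := by
  set A := ∑' i, (r i : ℝ≥0∞) ^ δ with hA
  have hd0 : 0 < d := hδ.trans_le hd
  have hdκ : 0 < d - κ := by linarith
  have hq : 0 ≤ δ / (d - κ) := by positivity
  have htq : t ^ (-(δ / (d - κ))) ≠ 0 := by
    simp [ENNReal.rpow_eq_zero_iff, ht0, htt]
  have htq' : t ^ (-(δ / (d - κ))) ≠ ∞ := by
    simp [ENNReal.rpow_eq_top_iff, ht0, htt]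
  rcases eq_or_ne A ∞ with hAt | hAt
  · rw [hAt, ENNReal.top_rpow_of_pos (by positivity), ENNReal.mul_top]
    · exact le_top
    · exact mul_ne_zero (by simp) htq
  have hsplit : A ^ (d / (d - κ)) = A ^ (κ / (d - κ)) * A := by
    nth_rw 3 [← ENNReal.rpow_one A]
    rw [← ENNReal.rpow_add_of_nonneg _ _ (by positivity) zero_le_one]
    congr 1
    field_simp
    ring
  set M := t ^ (-(δ / (d - κ))) * A ^ (κ / (d - κ)) with hM
  have hMt : M ≠ ∞ := ENNReal.mul_ne_top htq' (ENNReal.rpow_ne_top_of_nonneg (by positivity) hAt)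
  rw [hsplit, show ∀ a : ℝ≥0∞, a * t ^ (-(δ / (d - κ))) * (A ^ (κ / (d - κ)) * A) = a * (M * A) by
    intro a; rw [hM]; ring]
  rcases le_or_gt t (A ^ (κ / δ)) with hle | hgt
  swap
  · have hempty : {y | t < maximalDensity d κ E y} = ∅ := by
      refine Set.eq_empty_of_forall_notMem fun y hy => (hy.trans_le ?_).not_gt hgt
      refine (maximalDensity_le hδ hd hκ hκd E y).trans ?_
      exact ENNReal.rpow_le_rpow (iInf₂_le_of_le x r (iInf_le_of_le hE le_rfl)) (by positivity)
    rw [hempty, hausdorffContent_empty hδ]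
    exact zero_le
  have hM1 : 1 ≤ M := by
    calc (1 : ℝ≥0∞) = t ^ (-(δ / (d - κ))) * t ^ (δ / (d - κ)) := by
          rw [← ENNReal.rpow_add _ _ ht0 htt]; simp
      _ ≤ t ^ (-(δ / (d - κ))) * (A ^ (κ / δ)) ^ (δ / (d - κ)) := by gcongr
      _ = M := by
          rw [← ENNReal.rpow_mul, hM]; congr 2; field_simp
  set T₁ := ⋃ i, Metric.ball (x i) (2 * r i) with hT₁
  set T₂ := {y | t < maximalDensity d κ E y} \ T₁ with hT₂
  have hT₁le : hausdorffContent δ T₁ ≤ 2 ^ δ * (M * A) := by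
    calc hausdorffContent δ T₁ ≤ ∑' i, ((2 * r i : ℝ≥0) : ℝ≥0∞) ^ δ :=
          hausdorffContent_le_tsum hδ x (fun i => 2 * r i) (by simp [hT₁])
      _ = 2 ^ δ * (1 * A) := by
          rw [one_mul, hA, ← ENNReal.tsum_mul_left]
          congr 1 with i
          rw [ENNReal.coe_mul, ENNReal.mul_rpow_of_nonneg _ _ hδ.le, ENNReal.coe_ofNat]
      _ ≤ 2 ^ δ * (M * A) := by gcongr
  have hT₂le : hausdorffContent δ T₂ ≤ 11 ^ δ * (M * A) := by
    have hex : ∀ y ∈ T₂, ∃ ρ : ℝ, 0 < ρ ∧ ENNReal.ofReal ρ ^ δ ≤ M *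
        ∑' i : {i | x i ∈ Metric.closedBall y (2 * ρ)}, (r i : ℝ≥0∞) ^ δ := by
      rintro y ⟨hy, hyT⟩
      simp only [Set.mem_ofPred_eq, maximalDensity, lt_iSup_iff] at hy
      obtain ⟨ρ, hρ, hlt⟩ := hy
      exact ⟨ρ, hρ, rpow_radius_le_of_lt hδ hd hκ hκd x r hE ht0 htt hyT hρ hlt⟩
    choose! ρ hρ0 hρ using hex
    have hbdd : ∀ y ∈ T₂, 2 * ρ y ≤ 2 * ((M * A) ^ δ⁻¹).toReal := by
      intro y hy
      gcongr
      rw [← ENNReal.ofReal_le_iff_le_toReal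
        (ENNReal.rpow_ne_top_of_nonneg (by positivity) (ENNReal.mul_ne_top hMt hAt)),
        ENNReal.le_rpow_inv_iff hδ]
      refine (hρ y hy).trans ?_
      gcongr
      exact ENNReal.tsum_comp_le_tsum_of_injective Subtype.val_injective _
    obtain ⟨u, huT, hdisj, hcov⟩ := Vitali.exists_disjoint_subfamily_covering_enlargement_closedBall
      T₂ (fun y => y) (fun y => 2 * ρ y) _ hbdd 5 (by norm_num)
    have hucount : u.Countable := by
      refine hdisj.countable_of_nonempty_interior fun y hy => ⟨y, ?_⟩
      refine Metric.ball_subset_interior_closedBall (Metric.mem_ball_self ?_)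
      have := hρ0 y (huT hy)
      positivity
    have : Countable u := hucount.to_subtype
    -- The Vitali enlargement has radius `5 * (2 * ρ)`, and `11 * ρ` makes the ball open.
    calc hausdorffContent δ T₂ ≤ ∑' y : u, ((11 * (ρ y).toNNReal : ℝ≥0) : ℝ≥0∞) ^ δ := by
          refine hausdorffContent_le_tsum hδ (fun y : u => (y : EuclideanSpace ℝ (Fin n)))
            (fun y => 11 * (ρ y).toNNReal) fun y hy => ?_
          obtain ⟨b, hb, hsub⟩ := hcov y hy
          refine Set.mem_iUnion.2 ⟨⟨b, hb⟩, ?_⟩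
          have hb0 := hρ0 b (huT hb)
          have hmem := hsub (Metric.mem_closedBall_self (by have := hρ0 y hy; positivity))
          refine Metric.closedBall_subset_ball ?_ hmem
          rw [NNReal.coe_mul, Real.coe_toNNReal _ hb0.le, NNReal.coe_ofNat]
          linarith
      _ = ∑' y : u, 11 ^ δ * ENNReal.ofReal (ρ y) ^ δ := by
          congr 1 with y
          rw [ENNReal.coe_mul, ENNReal.mul_rpow_of_nonneg _ _ hδ.le, ENNReal.coe_ofNat,
            ENNReal.ofReal]
      _ ≤ ∑' y : u, 11 ^ δ * (M *
            ∑' i : {i | x i ∈ Metric.closedBall (y : EuclideanSpace ℝ (Fin n)) (2 * ρ y)},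
              (r i : ℝ≥0∞) ^ δ) := by
          refine ENNReal.tsum_le_tsum fun y => ?_
          gcongr
          exact hρ y (huT y.2)
      _ ≤ 11 ^ δ * (M * A) := by
          rw [ENNReal.tsum_mul_left, ENNReal.tsum_mul_left]
          gcongr
          rw [← ENNReal.tsum_sigma (β := fun y : u =>
            {i | x i ∈ Metric.closedBall (y : EuclideanSpace ℝ (Fin n)) (2 * ρ y)})
            (fun _ i => (r i : ℝ≥0∞) ^ δ)]
          refine ENNReal.tsum_comp_le_tsum_of_injective
            (f := fun z : (Σ y : u, {i | x i ∈ Metric.closedBall (y : EuclideanSpace ℝ (Fin n))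
              (2 * ρ y)}) => (z.2 : ℕ)) ?_ (fun i => (r i : ℝ≥0∞) ^ δ)
          rintro ⟨y, i, hi⟩ ⟨z, j, hj⟩ (rfl : i = j)
          have hyz : y = z := Subtype.ext (hdisj.elim_set y.2 z.2 (x i) hi hj)
          subst hyz
          rfl
  calc hausdorffContent δ {y | t < maximalDensity d κ E y}
      ≤ hausdorffContent δ (⋃ b : Bool, cond b T₁ T₂) := by
        refine hausdorffContent_mono fun y hy => ?_
        by_cases h : y ∈ T₁
        · exact Set.mem_iUnion.2 ⟨true, h⟩
        · exact Set.mem_iUnion.2 ⟨false, hy, h⟩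
    _ ≤ ∑' b : Bool, hausdorffContent δ (cond b T₁ T₂) := hausdorffContent_iUnion_le hδ _
    _ = hausdorffContent δ T₁ + hausdorffContent δ T₂ := by simp [tsum_fintype]
    _ ≤ 2 ^ δ * (M * A) + 11 ^ δ * (M * A) := add_le_add hT₁le hT₂le
    _ = (2 ^ δ + 11 ^ δ) * (M * A) := by ring

theorem hausdorffContent_lt_maximalDensity_le (hδ : 0 < δ) (hd : δ ≤ d) (hκ : 0 ≤ κ)
    (hκd : κ < d) (E : Set (EuclideanSpace ℝ (Fin n))) {t : ℝ≥0∞} (ht0 : t ≠ 0) (htt : t ≠ ∞) :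
    hausdorffContent δ {y | t < maximalDensity d κ E y} ≤
      (2 ^ δ + 11 ^ δ) * t ^ (-(δ / (d - κ))) * hausdorffContent δ E ^ (d / (d - κ)) := by
  set K : ℝ≥0∞ := (2 ^ δ + 11 ^ δ) * t ^ (-(δ / (d - κ)))
  have hK0 : K ≠ 0 := mul_ne_zero (by simp) (by simp [ENNReal.rpow_eq_zero_iff, ht0, htt])
  have hKt : K ≠ ∞ := by
    refine ENNReal.mul_ne_top ?_ (by simp [ENNReal.rpow_eq_top_iff, ht0, htt])
    exact ENNReal.add_ne_top.2 ⟨ENNReal.rpow_ne_top_of_nonneg hδ.le (by simp),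
      ENNReal.rpow_ne_top_of_nonneg hδ.le (by simp)⟩
  have hs : 0 < d / (d - κ) := div_pos (hδ.trans_le hd) (by linarith)
  rw [← ENNReal.div_le_iff' hK0 hKt, ← ENNReal.rpow_inv_le_iff hs]
  refine le_iInf₂ fun x r => le_iInf fun hE => ?_
  rw [ENNReal.rpow_inv_le_iff hs, ENNReal.div_le_iff' hK0 hKt]
  exact hausdorffContent_lt_maximalDensity_le_of_cover hδ hd hκ hκd x r hE ht0 htt

end Density

/-! ### Dyadic sums for Choquet integrals -/

theorem ofReal_two_rpow_zpow (α : ℝ) (m : ℤ) :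
    ENNReal.ofReal (((2 : ℝ) ^ α) ^ m) = (2 : ℝ≥0∞) ^ (α * m) := by
  rw [← Real.rpow_intCast, ← Real.rpow_mul zero_le_two,
    ← ENNReal.ofReal_rpow_of_pos zero_lt_two, ENNReal.ofReal_ofNat]

theorem tsum_two_rpow_neg_mul_ne_top {η : ℝ} (hη : 0 < η) :
    ∑' j : ℕ, (2 : ℝ≥0∞) ^ (-η * j) ≠ ∞ := by
  simp_rw [ENNReal.rpow_mul, ENNReal.rpow_natCast]
  rw [ENNReal.tsum_geometric, Ne, ENNReal.inv_eq_top, tsub_eq_zero_iff_le, not_le]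
  exact ENNReal.rpow_lt_one_of_one_lt_of_neg (by norm_num) (by linarith)

theorem tsum_int_two_rpow_neg_mul_abs_ne_top {η : ℝ} (hη : 0 < η) :
    ∑' j : ℤ, (2 : ℝ≥0∞) ^ (-η * |(j : ℝ)|) ≠ ∞ := by
  have hsurj : Function.Surjective (fun z : Bool × ℕ => cond z.1 (z.2 : ℤ) (-z.2)) := by
    intro j
    rcases Int.eq_nat_or_neg j with ⟨k, rfl | rfl⟩
    · exact ⟨(true, k), rfl⟩
    · exact ⟨(false, k), rfl⟩
  refine ne_top_of_le_ne_top ?_ (ENNReal.tsum_le_tsum_comp_of_surjective hsurj _)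
  rw [ENNReal.tsum_prod (f := fun (b : Bool) (j : ℕ) =>
    (2 : ℝ≥0∞) ^ (-η * |((cond b (j : ℤ) (-j) : ℤ) : ℝ)|)), tsum_fintype]
  simpa using tsum_two_rpow_neg_mul_ne_top hη

section Dyadic

variable {n : ℕ} {δ : ℝ}

theorem choquetIntegral_le_tsum (Ω : Set (EuclideanSpace ℝ (Fin n)))
    (g : EuclideanSpace ℝ (Fin n) → ℝ≥0∞) {α : ℝ} (hα : 0 < α) {s : ℝ≥0∞} (hs0 : s ≠ 0)
    (hst : s ≠ ∞) :
    choquetIntegral δ Ω g ≤ ∑' m : ℤ, s * 2 ^ (α * (m + 1)) *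
      hausdorffContent δ {x | x ∈ Ω ∧ s * 2 ^ (α * m) < g x} := by
  obtain ⟨s, hs, rfl⟩ : ∃ s' : ℝ, 0 < s' ∧ ENNReal.ofReal s' = s :=
    ⟨s.toReal, ENNReal.toReal_pos hs0 hst, ENNReal.ofReal_toReal hst⟩
  set b : ℝ := 2 ^ α with hb
  have hb1 : 1 < b := Real.one_lt_rpow one_lt_two hα
  have hval (m : ℤ) : ENNReal.ofReal s * 2 ^ (α * m) = ENNReal.ofReal (s * b ^ m) := by
    rw [ENNReal.ofReal_mul hs.le, ofReal_two_rpow_zpow]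
  have hcov : Set.Ioi (0 : ℝ) ⊆ ⋃ m : ℤ, Set.Ico (s * b ^ m) (s * b ^ (m + 1)) := by
    intro t ht
    obtain ⟨m, hm1, hm2⟩ := exists_mem_Ico_zpow (div_pos ht hs) hb1
    rw [le_div_iff₀' hs] at hm1
    rw [div_lt_iff₀' hs] at hm2
    exact Set.mem_iUnion.2 ⟨m, hm1, hm2⟩
  calc choquetIntegral δ Ω g
      ≤ ∫⁻ t in ⋃ m : ℤ, Set.Ico (s * b ^ m) (s * b ^ (m + 1)),
          hausdorffContent δ {x | x ∈ Ω ∧ ENNReal.ofReal t < g x} := lintegral_mono_set hcov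
    _ ≤ ∑' m : ℤ, ∫⁻ t in Set.Ico (s * b ^ m) (s * b ^ (m + 1)),
          hausdorffContent δ {x | x ∈ Ω ∧ ENNReal.ofReal t < g x} := lintegral_iUnion_le _ _
    _ ≤ _ := by
      refine ENNReal.tsum_le_tsum fun m => ?_
      have hval' : ENNReal.ofReal s * 2 ^ (α * ((m : ℝ) + 1)) =
          ENNReal.ofReal (s * b ^ (m + 1)) := by
        rw [← hval]; push_cast; rfl
      rw [hval', hval]
      calc ∫⁻ t in Set.Ico (s * b ^ m) (s * b ^ (m + 1)),
            hausdorffContent δ {x | x ∈ Ω ∧ ENNReal.ofReal t < g x}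
          ≤ ∫⁻ t in Set.Ico (s * b ^ m) (s * b ^ (m + 1)),
            hausdorffContent δ {x | x ∈ Ω ∧ ENNReal.ofReal (s * b ^ m) < g x} := by
            refine setLIntegral_mono' measurableSet_Ico fun t ht => hausdorffContent_mono ?_
            exact fun x hx => ⟨hx.1, (ENNReal.ofReal_le_ofReal ht.1).trans_lt hx.2⟩
        _ ≤ _ := by
            rw [setLIntegral_const, Real.volume_Ico, mul_comm]
            gcongr
            have : 0 < s * b ^ m := by positivity
            linarith

theorem tsum_le_choquetIntegral (Ω : Set (EuclideanSpace ℝ (Fin n)))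
    (g : EuclideanSpace ℝ (Fin n) → ℝ≥0∞) {α : ℝ} (hα : 0 < α) :
    ENNReal.ofReal (1 - 2 ^ (-α)) * ∑' m : ℤ, 2 ^ (α * m) *
      hausdorffContent δ {x | x ∈ Ω ∧ 2 ^ (α * m) < g x} ≤ choquetIntegral δ Ω g := by
  set b : ℝ := 2 ^ α with hb
  have hb1 : 1 < b := Real.one_lt_rpow one_lt_two hα
  have hb0 : 0 < b := zero_lt_one.trans hb1
  have hdisj : Pairwise (Function.onFun Disjoint
      fun m : ℤ => Set.Ico (b ^ (m - 1)) (b ^ m)) :=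
    (zpow_right_mono₀ hb1.le).pairwise_disjoint_on_Ico_pred
  calc ENNReal.ofReal (1 - 2 ^ (-α)) * ∑' m : ℤ, 2 ^ (α * m) *
        hausdorffContent δ {x | x ∈ Ω ∧ 2 ^ (α * m) < g x}
      ≤ ∑' m : ℤ, ∫⁻ t in Set.Ico (b ^ (m - 1)) (b ^ m),
          hausdorffContent δ {x | x ∈ Ω ∧ ENNReal.ofReal t < g x} := by
        rw [← ENNReal.tsum_mul_left]
        refine ENNReal.tsum_le_tsum fun m => ?_
        rw [← ofReal_two_rpow_zpow, ← mul_assoc, ← ENNReal.ofReal_mul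
          (by rw [Real.rpow_neg zero_le_two]; exact sub_nonneg.2 (inv_le_one_of_one_le₀ hb1.le)),
          ← hb, show (1 - (2 : ℝ) ^ (-α)) * b ^ m = b ^ m - b ^ (m - 1) by
            rw [Real.rpow_neg zero_le_two, ← hb, zpow_sub_one₀ hb0.ne']; ring,
          ← Real.volume_Ico, mul_comm, ← setLIntegral_const]
        refine setLIntegral_mono' measurableSet_Ico fun t ht => hausdorffContent_mono ?_
        exact fun x hx => ⟨hx.1, (ENNReal.ofReal_le_ofReal ht.2.le).trans_lt hx.2⟩
    _ = ∫⁻ t in ⋃ m : ℤ, Set.Ico (b ^ (m - 1)) (b ^ m),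
          hausdorffContent δ {x | x ∈ Ω ∧ ENNReal.ofReal t < g x} :=
        (lintegral_iUnion (fun _ => measurableSet_Ico) hdisj _).symm
    _ ≤ choquetIntegral δ Ω g := by
        refine lintegral_mono_set (Set.iUnion_subset fun m t ht => ?_)
        exact (zpow_pos hb0 _).trans_le ht.1

theorem fractionalMaximal_le_tsum (hn : 1 ≤ n) (κ : ℝ) (f : EuclideanSpace ℝ (Fin n) → EReal)
    (x : EuclideanSpace ℝ (Fin n)) :
    fractionalMaximal (n : ℝ) κ f x ≤
      2 * ∑' m : ℤ, 2 ^ (m : ℝ) * maximalDensity n κ {y | 2 ^ (m : ℝ) < (f y).abs} x := by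
  refine iSup₂_le fun r hr => ?_
  calc ENNReal.ofReal r ^ κ / hausdorffContent n (Metric.ball x r) *
        choquetIntegral n (Metric.ball x r) (fun y => (f y).abs)
      ≤ ENNReal.ofReal r ^ κ / ENNReal.ofReal r ^ (n : ℝ) * ∑' m : ℤ, 1 * 2 ^ (1 * ((m : ℝ) + 1)) *
          hausdorffContent n {y | y ∈ Metric.ball x r ∧ 1 * 2 ^ (1 * (m : ℝ)) < (f y).abs} := by
        gcongr
        · exact le_hausdorffContent_ball hn x hr
        · exact choquetIntegral_le_tsum _ _ one_pos one_ne_zero ENNReal.one_ne_top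
    _ = 2 * ∑' m : ℤ, 2 ^ (m : ℝ) * (ENNReal.ofReal r ^ κ / ENNReal.ofReal r ^ (n : ℝ) *
          hausdorffContent n (Metric.ball x r ∩ {y | 2 ^ (m : ℝ) < (f y).abs})) := by
        rw [← ENNReal.tsum_mul_left, ← ENNReal.tsum_mul_left]
        congr 1 with m
        simp only [one_mul]
        rw [ENNReal.rpow_add _ _ (by simp) (by simp), ENNReal.rpow_one,
          show Metric.ball x r ∩ {y | 2 ^ (m : ℝ) < (f y).abs} =
            {y | y ∈ Metric.ball x r ∧ 2 ^ (m : ℝ) < (f y).abs} from rfl]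
        ring
    _ ≤ _ := by
        gcongr with m
        exact le_iSup₂_of_le r hr le_rfl

end Dyadic

/-! ### Summation over the level sets -/

section LevelSets

variable {n : ℕ} {δ κ p η : ℝ}

theorem two_rpow_mul_two_rpow (a b : ℝ) : (2 : ℝ≥0∞) ^ a * 2 ^ b = 2 ^ (a + b) :=
  (ENNReal.rpow_add _ _ (by simp) (by simp)).symm

theorem le_mul_two_rpow_neg {a F : ℝ≥0∞} {u : ℝ} (h : 2 ^ u * a ≤ F) : a ≤ F * 2 ^ (-u) := by
  calc a = 2 ^ u * a * 2 ^ (-u) := by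
        rw [mul_right_comm, two_rpow_mul_two_rpow]; simp
    _ ≤ F * 2 ^ (-u) := by gcongr

/-- If the weighted contents `2 ^ (p m) 𝓗^δ_∞ (E m)` are at most `F` and the densities of the sets
`E m` with `m ≥ k` obey a geometrically decaying bound, then the whole dyadic sum is of order
`F ^ (κ / δ) * 2 ^ (k * θ)`, `θ = 1 - p * κ / δ`. The terms with `m < k` satisfy such a bound
unconditionally, by the supremum bound for the density. -/
theorem tsum_maximalDensity_le (hδ : 0 < δ) (hδn : δ ≤ n) (hκ : 0 ≤ κ) (hκδ : κ < δ)
    (hη : η ≤ 1 - p * κ / δ) (E : ℤ → Set (EuclideanSpace ℝ (Fin n))) {F : ℝ≥0∞}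
    (hF : ∀ m : ℤ, 2 ^ (p * m) * hausdorffContent δ (E m) ≤ F)
    (k : ℤ) (x : EuclideanSpace ℝ (Fin n))
    (hx : ∀ j : ℕ, maximalDensity n κ (E (k + j)) x ≤
      F ^ (κ / δ) * 2 ^ (k * (1 - p * κ / δ) - (k + j) - η * j)) :
    ∑' m : ℤ, 2 ^ (m : ℝ) * maximalDensity n κ (E m) x ≤
      (∑' j : ℤ, 2 ^ (-η * |(j : ℝ)|)) * (F ^ (κ / δ) * 2 ^ (k * (1 - p * κ / δ))) := by
  have hterm (m : ℤ) : 2 ^ (m : ℝ) * maximalDensity n κ (E m) x ≤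
      2 ^ (-η * |((m - k : ℤ) : ℝ)|) * (F ^ (κ / δ) * 2 ^ (k * (1 - p * κ / δ))) := by
    rcases le_or_gt k m with hkm | hmk
    · obtain ⟨j, rfl⟩ := Int.le.dest hkm
      calc (2 : ℝ≥0∞) ^ ((k + j : ℤ) : ℝ) * maximalDensity n κ (E (k + j)) x
          ≤ 2 ^ ((k + j : ℤ) : ℝ) *
            (F ^ (κ / δ) * 2 ^ (k * (1 - p * κ / δ) - (k + j) - η * j)) := by
            gcongr; exact hx j
        _ = _ := by
            rw [mul_left_comm, two_rpow_mul_two_rpow, mul_left_comm, two_rpow_mul_two_rpow]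
            congr 2
            rw [add_sub_cancel_left, Int.cast_natCast, Nat.abs_cast]
            push_cast
            ring
    · have hmk' : (m : ℝ) < k := by exact_mod_cast hmk
      calc (2 : ℝ≥0∞) ^ (m : ℝ) * maximalDensity n κ (E m) x
          ≤ 2 ^ (m : ℝ) * (F * 2 ^ (-(p * m))) ^ (κ / δ) := by
            gcongr
            refine (maximalDensity_le hδ hδn hκ (hκδ.trans_le hδn) _ _).trans ?_
            gcongr
            exact le_mul_two_rpow_neg (hF m)
        _ = F ^ (κ / δ) * 2 ^ (m * (1 - p * κ / δ)) := by
            rw [ENNReal.mul_rpow_of_nonneg _ _ (by positivity), ← ENNReal.rpow_mul, mul_left_comm,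
              two_rpow_mul_two_rpow]
            congr 2
            ring
        _ ≤ _ := by
            rw [mul_left_comm, two_rpow_mul_two_rpow]
            gcongr
            · norm_num
            · rw [Int.cast_sub, abs_of_neg (by linarith)]
              nlinarith
  calc ∑' m : ℤ, 2 ^ (m : ℝ) * maximalDensity n κ (E m) x
      ≤ ∑' m : ℤ, 2 ^ (-η * |((m - k : ℤ) : ℝ)|) * (F ^ (κ / δ) * 2 ^ (k * (1 - p * κ / δ))) :=
        ENNReal.tsum_le_tsum hterm
    _ = _ := by
        rw [ENNReal.tsum_mul_right]
        congr 1
        exact (Equiv.subRight k).tsum_eq fun j : ℤ => (2 : ℝ≥0∞) ^ (-η * |(j : ℝ)|)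

/-- The weak type estimate for `E m`, `m = k + j`, at the heights that occur in
`tsum_maximalDensity_le`. The powers of `F` cancel. -/
theorem hausdorffContent_lt_maximalDensity_level_le (hδ : 0 < δ) (hδn : δ ≤ n) (hκ : 0 ≤ κ)
    (hκδ : κ < δ) (E : Set (EuclideanSpace ℝ (Fin n))) {F : ℝ≥0∞} (hF0 : F ≠ 0) (hFt : F ≠ ∞)
    (k : ℤ) (j : ℕ) (hF : 2 ^ (p * (k + j)) * hausdorffContent δ E ≤ F) :
    hausdorffContent δ {x | F ^ (κ / δ) * 2 ^ (k * (1 - p * κ / δ) - (k + j) - η * j) <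
        maximalDensity n κ E x} ≤
      (2 ^ δ + 11 ^ δ) * (2 ^ (δ / (n - κ) * (1 - p * κ / δ + η) * j) *
        hausdorffContent δ E) := by
  set a := hausdorffContent δ E
  set e : ℝ := k * (1 - p * κ / δ) - (k + j) - η * j with he
  have hnκ : 0 < n - κ := by linarith
  have hL0 : F ^ (κ / δ) ≠ 0 := by simp [ENNReal.rpow_eq_zero_iff, hF0, hFt]
  have hLt : F ^ (κ / δ) ≠ ∞ := ENNReal.rpow_ne_top_of_nonneg (by positivity) hFt
  have h20 : (2 : ℝ≥0∞) ^ e ≠ 0 := by simp [ENNReal.rpow_eq_zero_iff]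
  have h2t : (2 : ℝ≥0∞) ^ e ≠ ∞ := by simp [ENNReal.rpow_eq_top_iff]
  refine (hausdorffContent_lt_maximalDensity_le hδ hδn hκ (hκδ.trans_le hδn) E
    (mul_ne_zero hL0 h20) (ENNReal.mul_ne_top hLt h2t)).trans ?_
  rw [mul_assoc]
  gcongr (2 ^ δ + 11 ^ δ) * ?_
  have hsplit : a ^ ((n : ℝ) / (n - κ)) = a ^ (κ / (n - κ)) * a := by
    nth_rw 3 [← ENNReal.rpow_one a]
    rw [← ENNReal.rpow_add_of_nonneg _ _ (by positivity) zero_le_one]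
    congr 1
    field_simp
    ring
  calc (F ^ (κ / δ) * 2 ^ e) ^ (-(δ / (n - κ))) * a ^ ((n : ℝ) / (n - κ))
      ≤ (F ^ (κ / δ) * 2 ^ e) ^ (-(δ / (n - κ))) *
          ((F * 2 ^ (-(p * (k + j)))) ^ (κ / (n - κ)) * a) := by
        rw [hsplit]
        gcongr
        exact le_mul_two_rpow_neg hF
    _ = F ^ (κ / δ * (-(δ / (n - κ))) + κ / (n - κ)) *
          (2 ^ (e * (-(δ / (n - κ))) + -(p * (k + j)) * (κ / (n - κ))) * a) := by
        rw [ENNReal.mul_rpow_of_ne_zero hL0 h20, ENNReal.mul_rpow_of_nonneg _ _ (by positivity),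
          ENNReal.rpow_add _ _ hF0 hFt, ← two_rpow_mul_two_rpow, ENNReal.rpow_mul,
          ENNReal.rpow_mul, ENNReal.rpow_mul 2 (-(p * (k + j)))]
        ring
    _ = 2 ^ (δ / (n - κ) * (1 - p * κ / δ + η) * j) * a := by
        rw [show κ / δ * (-(δ / (n - κ))) + κ / (n - κ) = 0 by field_simp; ring,
          ENNReal.rpow_zero, one_mul]
        congr 2
        rw [he]
        field_simp
        ring

/-- A superlevel set of the maximal function is controlled by the superlevel sets of `f` at
levels `2 ^ m`, `m ≥ k`, only. The truncation of `f` at `2 ^ k` stays below the given height. -/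
theorem hausdorffContent_lt_fractionalMaximal_le (hn : 1 ≤ n) (hδ : 0 < δ) (hδn : δ ≤ n)
    (hκ : 0 ≤ κ) (hκδ : κ < δ) (hη : η ≤ 1 - p * κ / δ)
    (f : EuclideanSpace ℝ (Fin n) → EReal) {F : ℝ≥0∞} (hF0 : F ≠ 0) (hFt : F ≠ ∞)
    (hF : ∀ m : ℤ, 2 ^ (p * m) * hausdorffContent δ {y | 2 ^ (m : ℝ) < (f y).abs} ≤ F) (k : ℤ) :
    hausdorffContent δ {x | 2 * ((∑' j : ℤ, 2 ^ (-η * |(j : ℝ)|)) *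
        (F ^ (κ / δ) * 2 ^ (k * (1 - p * κ / δ)))) < fractionalMaximal (n : ℝ) κ f x} ≤
      (2 ^ δ + 11 ^ δ) * ∑' j : ℕ, 2 ^ (δ / (n - κ) * (1 - p * κ / δ + η) * j) *
        hausdorffContent δ {y | 2 ^ ((k + j : ℤ) : ℝ) < (f y).abs} := by
  set E : ℤ → Set (EuclideanSpace ℝ (Fin n)) := fun m => {y | 2 ^ (m : ℝ) < (f y).abs} with hE
  calc _ ≤ hausdorffContent δ (⋃ j : ℕ, {x | F ^ (κ / δ) *
          2 ^ (k * (1 - p * κ / δ) - (k + j) - η * j) < maximalDensity n κ (E (k + j)) x}) := by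
        refine hausdorffContent_mono fun x hx => ?_
        by_contra hcon
        simp only [Set.mem_iUnion, Set.mem_ofPred_eq, not_exists, not_lt] at hcon
        refine (lt_of_lt_of_le (Set.mem_ofPred_eq ▸ hx) ?_).false
        refine (fractionalMaximal_le_tsum hn κ f x).trans ?_
        gcongr
        exact tsum_maximalDensity_le hδ hδn hκ hκδ hη E hF k x hcon
    _ ≤ ∑' j : ℕ, (2 ^ δ + 11 ^ δ) * (2 ^ (δ / (n - κ) * (1 - p * κ / δ + η) * j) *
          hausdorffContent δ (E (k + j))) := by
        refine (hausdorffContent_iUnion_le hδ _).trans (ENNReal.tsum_le_tsum fun j => ?_)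
        refine hausdorffContent_lt_maximalDensity_level_le hδ hδn hκ hκδ _ hF0 hFt k j ?_
        have h : 2 ^ (p * ((k + j : ℤ) : ℝ)) * hausdorffContent δ (E (k + j)) ≤ F := hF (k + j)
        rwa [Int.cast_add, Int.cast_natCast] at h
    _ = _ := ENNReal.tsum_mul_left

theorem fractionalMaximal_eq_zero (hn : 1 ≤ n) (hδ : 0 < δ) (hδn : δ ≤ n)
    (f : EuclideanSpace ℝ (Fin n) → EReal)
    (hf : ∀ m : ℤ, hausdorffContent δ {y | 2 ^ (m : ℝ) < (f y).abs} = 0)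
    (x : EuclideanSpace ℝ (Fin n)) : fractionalMaximal (n : ℝ) κ f x = 0 := by
  rw [← nonpos_iff_eq_zero]
  refine (fractionalMaximal_le_tsum hn κ f x).trans_eq ?_
  have hd0 : 0 < (n : ℝ) := hδ.trans_le hδn
  suffices ∀ m : ℤ, maximalDensity n κ {y | 2 ^ (m : ℝ) < (f y).abs} x = 0 by
    simp only [this, mul_zero, tsum_zero]
  intro m
  have hzero (r : ℝ) :
      hausdorffContent n (Metric.ball x r ∩ {y | 2 ^ (m : ℝ) < (f y).abs}) = 0 := by
    rw [← nonpos_iff_eq_zero]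
    refine (hausdorffContent_mono Set.inter_subset_right).trans
      ((hausdorffContent_le_rpow hδ hδn _).trans_eq ?_)
    rw [hf, ENNReal.zero_rpow_of_pos (by positivity)]
  simp only [maximalDensity, hzero, mul_zero, ENNReal.iSup_zero]

/-- The strong type estimate in terms of the dyadic sum `∑ 2 ^ (p m) 𝓗^δ_∞ {|f| > 2 ^ m}`, before
roots are taken. The exponent satisfies `q * (1 - p * κ / δ) = p`. -/
theorem choquetIntegral_fractionalMaximal_rpow_le (hn : 1 ≤ n) (hδ : 0 < δ) (hδn : δ ≤ n)
    (hκ : 0 ≤ κ) (hκδ : κ < δ) (hp0 : 0 < p) (hη0 : 0 < η) (hη : η ≤ 1 - p * κ / δ)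
    {q : ℝ} (hq0 : 0 < q) (hq : q * (1 - p * κ / δ) = p)
    (f : EuclideanSpace ℝ (Fin n) → EReal) {F : ℝ≥0∞}
    (hF : F = ∑' m : ℤ, 2 ^ (p * m) * hausdorffContent δ {y | 2 ^ (m : ℝ) < (f y).abs})
    (hFt : F ≠ ∞) :
    choquetIntegral δ Set.univ (fun x => fractionalMaximal (n : ℝ) κ f x ^ q) ≤
      (2 * ∑' j : ℤ, 2 ^ (-η * |(j : ℝ)|)) ^ q * (2 ^ p * ((2 ^ δ + 11 ^ δ) *
        ∑' j : ℕ, 2 ^ (-(p - δ / (n - κ) * (1 - p * κ / δ + η)) * j))) * F ^ (q / p) := by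
  set a : ℤ → ℝ≥0∞ := fun m => hausdorffContent δ {y | 2 ^ (m : ℝ) < (f y).abs} with ha
  set D : ℝ≥0∞ := ∑' j : ℤ, 2 ^ (-η * |(j : ℝ)|) with hD
  set θ : ℝ := 1 - p * κ / δ with hθ
  set C : ℝ≥0∞ := 2 ^ δ + 11 ^ δ with hC
  set B : ℝ := δ / (n - κ) * (θ + η) with hB
  rcases eq_or_ne F 0 with hF0 | hF0
  · have hzero (m : ℤ) : hausdorffContent δ {y | 2 ^ (m : ℝ) < (f y).abs} = 0 := by
      have h := (hF ▸ hF0 : ∑' m : ℤ, 2 ^ (p * m) * a m = 0)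
      have h2 := ENNReal.tsum_eq_zero.1 h m
      simpa [ENNReal.rpow_eq_zero_iff] using h2
    simp [choquetIntegral, fractionalMaximal_eq_zero hn hδ hδn f hzero,
      ENNReal.zero_rpow_of_pos hq0, hausdorffContent_empty hδ]
  have hFm (m : ℤ) : 2 ^ (p * m) * a m ≤ F := hF ▸ ENNReal.le_tsum m
  have hL0 : F ^ (κ / δ) ≠ 0 := by simp [ENNReal.rpow_eq_zero_iff, hF0, hFt]
  have hLt : F ^ (κ / δ) ≠ ∞ := ENNReal.rpow_ne_top_of_nonneg (by positivity) hFt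
  have hDt : D ≠ ∞ := tsum_int_two_rpow_neg_mul_abs_ne_top hη0
  have hD0 : D ≠ 0 := by
    refine (lt_of_lt_of_le one_pos (le_trans ?_ (ENNReal.le_tsum (0 : ℤ)))).ne'
    simp
  set s : ℝ≥0∞ := (2 * (D * F ^ (κ / δ))) ^ q with hs
  have hbase0 : 2 * (D * F ^ (κ / δ)) ≠ 0 := mul_ne_zero (by simp) (mul_ne_zero hD0 hL0)
  have hbaset : 2 * (D * F ^ (κ / δ)) ≠ ∞ :=
    ENNReal.mul_ne_top (by simp) (ENNReal.mul_ne_top hDt hLt)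
  have hs0 : s ≠ 0 := by simp [hs, ENNReal.rpow_eq_zero_iff, hbase0, hbaset]
  have hst : s ≠ ∞ := ENNReal.rpow_ne_top_of_nonneg hq0.le hbaset
  have hlevel (k : ℤ) : {x | x ∈ Set.univ ∧ s * 2 ^ (p * k) < fractionalMaximal (n : ℝ) κ f x ^ q} =
      {x | 2 * (D * (F ^ (κ / δ) * 2 ^ (k * θ))) < fractionalMaximal (n : ℝ) κ f x} := by
    ext x
    have hpow : s * 2 ^ (p * k) = (2 * (D * (F ^ (κ / δ) * 2 ^ (k * θ)))) ^ q := by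
      rw [show 2 * (D * (F ^ (κ / δ) * 2 ^ (k * θ))) = 2 * (D * F ^ (κ / δ)) * 2 ^ (k * θ) by ring,
        ENNReal.mul_rpow_of_nonneg _ _ hq0.le, ← ENNReal.rpow_mul, ← hs]
      congr 2
      rw [← hq]
      ring
    simp only [Set.mem_ofPred_eq, Set.mem_univ, true_and]
    rw [hpow, ENNReal.rpow_lt_rpow_iff hq0]
  calc choquetIntegral δ Set.univ (fun x => fractionalMaximal (n : ℝ) κ f x ^ q)
      ≤ ∑' k : ℤ, s * 2 ^ (p * ((k : ℝ) + 1)) *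
          (C * ∑' j : ℕ, 2 ^ (B * j) * a (k + j)) := by
        refine (choquetIntegral_le_tsum _ _ hp0 hs0 hst).trans (ENNReal.tsum_le_tsum fun k => ?_)
        gcongr
        rw [hlevel]
        exact hausdorffContent_lt_fractionalMaximal_le hn hδ hδn hκ hκδ hη f hF0 hFt hFm k
    _ = s * 2 ^ p * C * ∑' k : ℤ, ∑' j : ℕ, 2 ^ (-(p - B) * j) *
          (2 ^ (p * (k + j : ℤ)) * a (k + j)) := by
        rw [← ENNReal.tsum_mul_left]
        congr 1 with k
        rw [show p * ((k : ℝ) + 1) = p + p * k by ring, ← two_rpow_mul_two_rpow,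
          show ∀ y : ℝ≥0∞, s * (2 ^ p * 2 ^ (p * (k : ℝ))) * (C * y) =
            s * 2 ^ p * C * (2 ^ (p * (k : ℝ)) * y) by intro y; ring,
          ← ENNReal.tsum_mul_left]
        congr 2 with j
        rw [← mul_assoc, ← mul_assoc, two_rpow_mul_two_rpow, two_rpow_mul_two_rpow]
        congr 2
        push_cast
        ring
    _ = s * 2 ^ p * C * ((∑' j : ℕ, 2 ^ (-(p - B) * j)) * F) := by
        rw [ENNReal.tsum_comm, ← ENNReal.tsum_mul_right]
        congr 2 with j
        rw [ENNReal.tsum_mul_left, hF]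
        congr 1
        exact (Equiv.addRight (j : ℤ)).tsum_eq fun m : ℤ => 2 ^ (p * m) * a m
    _ = (2 * D) ^ q * (2 ^ p * (C * ∑' j : ℕ, 2 ^ (-(p - B) * j))) * F ^ (q / p) := by
        have hFq : F ^ (q / p) = (F ^ (κ / δ)) ^ q * F := by
          nth_rw 3 [← ENNReal.rpow_one F]
          rw [← ENNReal.rpow_mul, ← ENNReal.rpow_add _ _ hF0 hFt]
          congr 1
          rw [div_eq_iff hp0.ne']
          nth_rw 1 [show q = q * θ + q * (p * κ / δ) by rw [hθ]; ring]
          rw [hq]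
          ring
        rw [hFq, hs, show 2 * (D * F ^ (κ / δ)) = 2 * D * F ^ (κ / δ) by ring,
          ENNReal.mul_rpow_of_nonneg _ _ hq0.le]
        ring

end LevelSets

theorem mainTheorem5 (n : ℕ) (hn : 1 ≤ n) (δ κ p : ℝ)
    (hδ : 0 < δ) (hδn : δ ≤ n) (hκ : 0 ≤ κ) (hκδ : κ < δ)
    (hp : δ / n < p) (hpκ : p * κ < δ) :
    ∃ c : ℝ≥0, ∀ f : EuclideanSpace ℝ (Fin n) → EReal,
      (choquetIntegral δ Set.univ
          (fun x => fractionalMaximal (n : ℝ) κ f x ^ (δ * p / (δ - p * κ)))) ^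
            ((δ - p * κ) / (δ * p)) ≤
        (c : ℝ≥0∞) * (choquetIntegral δ Set.univ (fun x => (f x).abs ^ p)) ^ (1 / p) := by
  have hn0 : 0 < (n : ℝ) := by exact_mod_cast hn
  have hp0 : 0 < p := lt_trans (by positivity) hp
  have hnκ : 0 < (n : ℝ) - κ := by linarith
  have hpn : δ < p * n := (div_lt_iff₀ hn0).1 hp
  have hδp : 0 < δ - p * κ := by linarith
  set q : ℝ := δ * p / (δ - p * κ) with hqdef
  have hq0 : 0 < q := by positivity
  have hθ0 : 0 < 1 - p * κ / δ := by
    rw [sub_pos, div_lt_one hδ]; exact hpκ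
  have hq : q * (1 - p * κ / δ) = p := by
    rw [hqdef]; field_simp
  -- `η` is below `θ = 1 - p κ / δ`, for the small levels, and so small that the exponent
  -- `p - δ / (n - κ) * (θ + η)` of the final geometric series is positive.
  set η : ℝ := min (1 - p * κ / δ) ((p * n / δ - 1) / 2) with hηdef
  have hgap : 0 < p * n / δ - 1 := by rw [sub_pos, one_lt_div hδ]; exact hpn
  have hη0 : 0 < η := lt_min hθ0 (by linarith)
  have hB : 0 < p - δ / (n - κ) * (1 - p * κ / δ + η) := by
    have h1 : η ≤ (p * n / δ - 1) / 2 := min_le_right _ _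
    have h2 : 1 - p * κ / δ + η < p * (n - κ) / δ := by
      have h3 : p * (n - κ) / δ = p * n / δ - p * κ / δ := by ring
      linarith
    calc (0 : ℝ) = p - δ / (n - κ) * (p * (n - κ) / δ) := by field_simp; ring
      _ < _ := by gcongr
  set C₁ : ℝ≥0∞ := (2 * ∑' j : ℤ, 2 ^ (-η * |(j : ℝ)|)) ^ q * (2 ^ p * ((2 ^ δ + 11 ^ δ) *
        ∑' j : ℕ, 2 ^ (-(p - δ / (n - κ) * (1 - p * κ / δ + η)) * j))) with hC₁
  have hC₁t : C₁ ≠ ∞ := by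
    refine ENNReal.mul_ne_top (ENNReal.rpow_ne_top_of_nonneg hq0.le (ENNReal.mul_ne_top (by simp)
      (tsum_int_two_rpow_neg_mul_abs_ne_top hη0))) (ENNReal.mul_ne_top
      (ENNReal.rpow_ne_top_of_nonneg hp0.le (by simp)) (ENNReal.mul_ne_top
        (ENNReal.add_ne_top.2 ⟨ENNReal.rpow_ne_top_of_nonneg hδ.le (by simp),
          ENNReal.rpow_ne_top_of_nonneg hδ.le (by simp)⟩)
        (tsum_two_rpow_neg_mul_ne_top hB)))
  set ε : ℝ≥0∞ := ENNReal.ofReal (1 - 2 ^ (-p)) with hε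
  have hε0 : ε ≠ 0 := by
    rw [hε, Ne, ENNReal.ofReal_eq_zero, not_le, sub_pos]
    exact Real.rpow_lt_one_of_one_lt_of_neg one_lt_two (by linarith)
  have hεt : ε ≠ ∞ := ENNReal.ofReal_ne_top
  have hKt : C₁ ^ (1 / q) * (ε⁻¹) ^ (1 / p) ≠ ∞ :=
    ENNReal.mul_ne_top (ENNReal.rpow_ne_top_of_nonneg (by positivity) hC₁t)
      (ENNReal.rpow_ne_top_of_nonneg (by positivity) (ENNReal.inv_ne_top.2 hε0))
  -- Adding `1` makes the constant nonzero, so that the estimate is trivial when the right-hand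
  -- integral is infinite.
  refine ⟨(C₁ ^ (1 / q) * (ε⁻¹) ^ (1 / p)).toNNReal + 1, fun f => ?_⟩
  rw [ENNReal.coe_add, ENNReal.coe_toNNReal hKt, ENNReal.coe_one,
    show (δ - p * κ) / (δ * p) = 1 / q by rw [hqdef, one_div_div]]
  set I := choquetIntegral δ Set.univ (fun x => (f x).abs ^ p) with hI
  rcases eq_or_ne I ∞ with hIt | hIt
  · rw [hIt, ENNReal.top_rpow_of_pos (by positivity), ENNReal.mul_top (by simp)]
    exact le_top
  set F : ℝ≥0∞ := ∑' m : ℤ, 2 ^ (p * m) * hausdorffContent δ {y | 2 ^ (m : ℝ) < (f y).abs} with hF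
  have hFI : F ≤ ε⁻¹ * I := by
    have h := tsum_le_choquetIntegral (δ := δ) Set.univ (fun x => (f x).abs ^ p) hp0
    have hset (m : ℤ) : {x | x ∈ Set.univ ∧ 2 ^ (p * m) < (f x).abs ^ p} =
        {y | 2 ^ (m : ℝ) < (f y).abs} := by
      ext x
      simp only [Set.mem_ofPred_eq, Set.mem_univ, true_and]
      rw [mul_comm p, ENNReal.rpow_mul, ENNReal.rpow_lt_rpow_iff hp0]
    simp only [hset] at h
    rw [← ENNReal.div_eq_inv_mul, ENNReal.le_div_iff_mul_le (Or.inl hε0) (Or.inl hεt), mul_comm]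
    exact h
  have hFt : F ≠ ∞ := ne_top_of_le_ne_top (ENNReal.mul_ne_top (ENNReal.inv_ne_top.2 hε0) hIt) hFI
  calc (choquetIntegral δ Set.univ (fun x => fractionalMaximal (n : ℝ) κ f x ^ q)) ^ (1 / q)
      ≤ (C₁ * F ^ (q / p)) ^ (1 / q) := by
        gcongr
        exact choquetIntegral_fractionalMaximal_rpow_le hn hδ hδn hκ hκδ hp0 hη0 (min_le_left _ _)
          hq0 hq f hF hFt
    _ = C₁ ^ (1 / q) * F ^ (1 / p) := by
        rw [ENNReal.mul_rpow_of_nonneg _ _ (by positivity), ← ENNReal.rpow_mul]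
        congr 2
        field_simp
    _ ≤ C₁ ^ (1 / q) * (ε⁻¹ * I) ^ (1 / p) := by gcongr
    _ = C₁ ^ (1 / q) * (ε⁻¹) ^ (1 / p) * I ^ (1 / p) := by
        rw [ENNReal.mul_rpow_of_nonneg ε⁻¹ I (by positivity), mul_assoc]
    _ ≤ (C₁ ^ (1 / q) * (ε⁻¹) ^ (1 / p) + 1) * I ^ (1 / p) := by
        gcongr
        exact le_self_add
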